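/- Let $(X,d,\mathfrak m)$ be a metric measure space, i.e. $(X,d)$ is a complete separable metric space and $\mathfrak m$ is a nonnegative Borel measure that is finite on bounded sets. For a Borel measure $\nu$ on $X$, $u\in L^1_{\rm loc}(\nu)$ and an open set $A\subset X$, let $$|Du|(A)=\inf\Big\{\liminf_{n\to\infty}\int_A {\rm lip}\,u_n\,d\nu \;:\; u_n\in{\rm Lip}_{\rm loc}(A),\ u_n\to u \text{ in } L^1_{\rm loc}(\nu|_A)\Big\},\qquad {\rm lip}\,v(x)=\limsup_{y\to x,\ y\neq x}\frac{|v(y)-v(x)|}{d(x,y)}$$ (with ${\rm lip}\,v(x)=0$ at isolated points), where "locally" means "on a neighbourhood of every point", and let $|Du|(S)=\inf\{|Du|(A): A\supset S \text{ open}\}$ for Borel $S\subset X$. For a Borel set $B\subset X$, let $|Du|_B$ denote the total variation $|Du|$ computed in $(X,d,\mathfrak m|_B)$. Let $\mathring{BV}(B)$ be the space of ($\mathfrak m|_B$-a.e. classes of) functions $u\in L^1_{\rm loc}(\mathfrak m|_B)$ with $\|u\|_{\mathring{BV}(B)}:=|Du|_B(B)<\infty$. A Borel set $E\subset X$ is called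 a $\mathring{BV}$-extension set if there are a constant $C\ge 1$ and a (not necessarily linear) map $T\colon \mathring{BV}(E)\to\mathring{BV}(X)$ such that $Tu=u$ $\mathfrak m$-a.e. on $E$ and $\|Tu\|_{\mathring{BV}(X)}\le C\|u\|_{\mathring{BV}(E)}$ for every $u\in\mathring{BV}(E)$. For Borel sets $B,E,F\subset X$ let $P_B(E,F)=|D\chi_E|_B(B\cap F)$. A Borel set $E$ with $P_B(E,B)<\infty$ is called decomposable with respect to $B$ if $E\cap B$ can be partitioned into two Borel sets $F,G$ with $\mathfrak m(F)>0$, $\mathfrak m(G)>0$ and $P_B(E,B)=P_B(F,B)+P_B(G,B)$; otherwise it is called indecomposable with respect to $B$. The space $X$ is called indecomposable if the set $X$ is indecomposable with respect to $X$. Suppose that $X$ is indecomposable, and let $E\subset X$ be a closed $\mathring{BV}$-extension set. Then $E$ has finite perimeter on $E$, i.e. $P_E(E,E)<\infty$, and $E$ is indecomposable with respect to $E$. -/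

import Mathlib

open MeasureTheory Filter Topology
open scoped ENNReal NNReal

namespace MetricBV

/-- The (pointwise) local Lipschitz constant `lip u x = limsup_{y → x, y ≠ x} d(u y, u x) / d(x, y)`.
At an isolated point the filter `𝓝[≠] x` is trivial and the value is `0`. -/
noncomputable def lip {X : Type*} [MetricSpace X] (u : X → ℝ) (x : X) : ℝ≥0∞ :=
  limsup (fun y => edist (u y) (u x) / edist x y) (𝓝[≠] x)

/-- `v n → u` in `L¹_loc(ν restricted to A)`, for an open set `A`: every point of `A` has a
neighbourhood inside `A` on which the functions converge in `L¹(ν)`. -/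
def TendstoL1Loc {X : Type*} [MetricSpace X] [MeasurableSpace X] (ν : Measure X) (A : Set X)
    (v : ℕ → X → ℝ) (u : X → ℝ) : Prop :=
  ∀ x ∈ A, ∃ U ∈ 𝓝 x, U ⊆ A ∧
    Tendsto (fun n => ∫⁻ y in U, ‖v n y - u y‖ₑ ∂ν) atTop (𝓝 0)

/-- The total variation `|Du|(A)` of `u` on an open set `A`, in the metric measure space
`(X, d, ν)`. A locally Lipschitz function on `A` is represented by a function on `X` whose values
outside `A` are irrelevant (for `x ∈ A`, `lip (v n) x` only depends on `v n` near `x`). -/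
noncomputable def totalVariationOpen {X : Type*} [MetricSpace X] [MeasurableSpace X]
    (ν : Measure X) (u : X → ℝ) (A : Set X) : ℝ≥0∞ :=
  ⨅ (v : ℕ → X → ℝ) (_ : ∀ n, LocallyLipschitzOn A (v n)) (_ : TendstoL1Loc ν A v u),
    liminf (fun n => ∫⁻ x in A, lip (v n) x ∂ν) atTop

/-- The total variation `|Du|(S) = inf {|Du|(A) : A open, S ⊆ A}` of a Borel set `S`, in the
metric measure space `(X, d, ν)`. With `ν = μ.restrict B` this is `|Du|_B(S)`. -/
noncomputable def totalVariation {X : Type*} [MetricSpace X] [MeasurableSpace X]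
    (ν : Measure X) (u : X → ℝ) (S : Set X) : ℝ≥0∞ :=
  ⨅ (A : Set X) (_ : IsOpen A) (_ : S ⊆ A), totalVariationOpen ν u A

/-- The homogeneous seminorm `‖u‖ = |Du|_B(B)`, for `u ∈ L⁰(μ restricted to B)`. -/
noncomputable def homBVSeminorm {X : Type*} [MetricSpace X] [MeasurableSpace X]
    (μ : Measure X) (B : Set X) (u : X →ₘ[μ.restrict B] ℝ) : ℝ≥0∞ :=
  totalVariation (μ.restrict B) u B

/-- The homogeneous space of functions of bounded variation on a Borel set `B`: the classes
`u ∈ L¹_loc(μ restricted to B)` with `|Du|_B(B) < ∞`. -/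
def homBV {X : Type*} [MetricSpace X] [MeasurableSpace X]
    (μ : Measure X) (B : Set X) : Set (X →ₘ[μ.restrict B] ℝ) :=
  {u | LocallyIntegrable u (μ.restrict B) ∧ homBVSeminorm μ B u < ∞}

/-- `E` has the extension property for the homogeneous `BV` space: there is a (not necessarily
linear) bounded extension operator `T`. -/
def IsHomBVExtensionSet {X : Type*} [MetricSpace X] [MeasurableSpace X]
    (μ : Measure X) (E : Set X) : Prop :=
  ∃ (C : ℝ≥0) (T : homBV μ E → homBV μ Set.univ), 1 ≤ C ∧
    (∀ u : homBV μ E,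
      ((T u : X →ₘ[μ.restrict Set.univ] ℝ) : X → ℝ) =ᵐ[μ.restrict E]
        ((u : X →ₘ[μ.restrict E] ℝ) : X → ℝ)) ∧
    (∀ u : homBV μ E,
      homBVSeminorm μ Set.univ (T u : X →ₘ[μ.restrict Set.univ] ℝ) ≤
        C * homBVSeminorm μ E (u : X →ₘ[μ.restrict E] ℝ))

/-- The perimeter `P_B(E, F) = |Dχ_E|_B(B ∩ F)`. -/
noncomputable def perimeter {X : Type*} [MetricSpace X] [MeasurableSpace X]
    (μ : Measure X) (B E F : Set X) : ℝ≥0∞ :=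
  totalVariation (μ.restrict B) (E.indicator fun _ => (1 : ℝ)) (B ∩ F)

/-- `E` is a (Borel) set of finite perimeter on `B`. -/
def HasFinitePerimeterOn {X : Type*} [MetricSpace X] [MeasurableSpace X]
    (μ : Measure X) (B E : Set X) : Prop :=
  MeasurableSet E ∧ perimeter μ B E B < ∞

/-- `E` is decomposable with respect to `B`: `E ∩ B` has a partition into Borel sets `F`, `G` of
positive measure with `P_B(E, B) = P_B(F, B) + P_B(G, B)`. -/
def IsDecomposableWrt {X : Type*} [MetricSpace X] [MeasurableSpace X]
    (μ : Measure X) (B E : Set X) : Prop :=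
  ∃ F G : Set X, MeasurableSet F ∧ MeasurableSet G ∧ F ∪ G = E ∩ B ∧ Disjoint F G ∧
    0 < μ F ∧ 0 < μ G ∧ perimeter μ B E B = perimeter μ B F B + perimeter μ B G B

/-- `E` is indecomposable with respect to `B`: it is a set of finite perimeter on `B` that is not
decomposable with respect to `B`. -/
def IsIndecomposableWrt {X : Type*} [MetricSpace X] [MeasurableSpace X]
    (μ : Measure X) (B E : Set X) : Prop :=
  HasFinitePerimeterOn μ B E ∧ ¬ IsDecomposableWrt μ B E

end MetricBV

/-!
If `E` splits into two pieces `F`, `G` of positive measure with `P_E(F, E) + P_E(G, E) = P_E(E, E)`,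
then both summands vanish, because `χ_E` is constant almost everywhere for `μ.restrict E`. Hence
`χ_F` has seminorm zero in the homogeneous space on `E`, and its extension `u` satisfies
`|Du|(X) = 0`, `u = 1` on `F` and `u = 0` on `G`. The coarea inequality shows that for almost every
`t` the superlevel set `{u > t}` has perimeter zero in `X`
(`ae_totalVariationOpen_superlevel_eq_zero`). For such a `t` in `(0, 1)`, the set `{u > t}` and its
complement both have positive measure and decompose `X`, which is impossible.

The coarea inequality (`exists_lintegral_le_of_totalVariationOpen_lt`) is proved directly from
the relaxation. If `v n → u` is a sequence of locally Lipschitz functions of energy at most `c`, the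
functions `ramp h t ∘ v n` (a linear cut-off between the levels `t` and `t + h`) are approximations
of `χ_{u > t}` with energy at most `h⁻¹ ∫_{t ≤ v n ≤ t + h} lip (v n)`. By Tonelli's theorem, the
integral over `t` of this bound is at most `c`, and the integral over `t` of the local `L¹` error is
controlled by that of `v n` plus `h`. Fatou's lemma and a summable choice of errors conclude.

Even if `|Du|(X) = 0`, no diagonal sequence with energies tending to zero is extracted: the
neighbourhoods in `TendstoL1Loc` depend on the sequence, so they could shrink along the diagonal.
Instead, the coarea inequality is applied for each energy bound `c = 2⁻ʲ` separately, and the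
resulting bounds for the perimeter of `{u > t}` tend to zero for almost every `t`.
-/

namespace MetricBV

open Set

variable {X : Type*} [MetricSpace X]

/-! ### The pointwise Lipschitz constant -/

theorem lip_eq_zero_of_eventually_eq {v : X → ℝ} {x : X} (h : ∀ᶠ y in 𝓝 x, v y = v x) :
    lip v x = 0 := by
  refine le_antisymm (limsup_le_of_le (by isBoundedDefault) ?_) bot_le
  filter_upwards [nhdsWithin_le_nhds h] with y hy
  simp [hy]

theorem lip_comp_le {K : ℝ≥0} {ψ : ℝ → ℝ} (hψ : LipschitzWith K ψ) (v : X → ℝ) (x : X) :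
    lip (ψ ∘ v) x ≤ K * lip v x := by
  unfold lip
  rw [← ENNReal.limsup_const_mul_of_ne_top ENNReal.coe_ne_top]
  refine limsup_le_limsup (Eventually.of_forall fun y => ?_)
  simp only [Function.comp_apply, ← mul_div_assoc]
  exact ENNReal.div_le_div_right (hψ _ _) _

/-! ### Linear cut-offs -/

/-- The piecewise linear function of `s` equal to `0` for `s ≤ t` and to `1` for `s ≥ t + h`. -/
noncomputable def ramp (h t s : ℝ) : ℝ := max 0 (min 1 (h⁻¹ * (s - t)))

theorem ramp_of_le {h t s : ℝ} (hh : 0 < h) (hs : s ≤ t) : ramp h t s = 0 := by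
  have : h⁻¹ * (s - t) ≤ 0 := mul_nonpos_of_nonneg_of_nonpos (by positivity) (by linarith)
  exact max_eq_left ((min_le_right _ _).trans this)

theorem ramp_of_ge {h t s : ℝ} (hh : 0 < h) (hs : t + h ≤ s) : ramp h t s = 1 := by
  have : 1 ≤ h⁻¹ * (s - t) := by
    rw [← inv_mul_cancel₀ hh.ne']
    exact mul_le_mul_of_nonneg_left (by linarith) (by positivity)
  simp [ramp, min_eq_left this]

theorem lipschitzWith_ramp {h : ℝ} (hh : 0 < h) (t : ℝ) :
    LipschitzWith (Real.toNNReal h⁻¹) (ramp h t) := by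
  have : LipschitzWith (Real.toNNReal h⁻¹) fun s : ℝ => h⁻¹ * (s - t) := by
    refine LipschitzWith.of_dist_le_mul fun a b => ?_
    rw [Real.coe_toNNReal _ (by positivity), Real.dist_eq, Real.dist_eq, ← mul_sub, abs_mul,
      abs_of_pos (inv_pos.2 hh)]
    simp
  exact (this.const_min 1).const_max 0

theorem continuous_ramp (h : ℝ) : Continuous fun p : ℝ × ℝ => ramp h p.1 p.2 := by
  unfold ramp
  fun_prop

theorem abs_ramp_sub_le_one (h t s : ℝ) (p : Prop) [Decidable p] :
    |ramp h t s - if p then 1 else 0| ≤ 1 := by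
  have h0 : 0 ≤ ramp h t s := le_max_left _ _
  have h1 : ramp h t s ≤ 1 := max_le zero_le_one (min_le_left _ _)
  rw [abs_le]
  split_ifs <;> constructor <;> linarith

theorem lip_ramp_comp_le {h : ℝ} (hh : 0 < h) (t : ℝ) {v : X → ℝ} (hv : Continuous v) (x : X) :
    lip (ramp h t ∘ v) x ≤
      (Real.toNNReal h⁻¹ : ℝ≥0∞) * ({x | t ≤ v x ∧ v x ≤ t + h}.indicator (lip v) x) := by
  by_cases hx : t ≤ v x ∧ v x ≤ t + h
  · rw [indicator_of_mem (by exact hx)]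
    exact lip_comp_le (lipschitzWith_ramp hh t) v x
  · -- off the closed strip, continuity makes the cut-off locally constant
    rw [lip_eq_zero_of_eventually_eq]
    · exact bot_le
    rw [not_and_or, not_le, not_le] at hx
    rcases hx with hx | hx
    · filter_upwards [hv.continuousAt.eventually (gt_mem_nhds hx)] with y hy
      simp [ramp_of_le hh hy.le, ramp_of_le hh hx.le]
    · filter_upwards [hv.continuousAt.eventually (lt_mem_nhds hx)] with y hy
      simp [ramp_of_ge hh hy.le, ramp_of_ge hh hx.le]

/-- Integrated over the level `t`, the distance between the cut-off of `a` and the indicator of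
`t < b` is at most `|a - b| + h`: the integrand is bounded by `1` and vanishes outside
`[a - h, b] ∪ [b, a]`. -/
theorem lintegral_enorm_ramp_sub_le {h : ℝ} (hh : 0 < h) (a b : ℝ) :
    ∫⁻ t, ‖ramp h t a - if t < b then 1 else 0‖ₑ ≤ ‖a - b‖ₑ + ENNReal.ofReal h := by
  have key : ∀ t, ‖ramp h t a - if t < b then 1 else 0‖ₑ ≤
      (Icc (a - h) b ∪ Icc b a).indicator 1 t := by
    intro t
    by_cases ht : t ∈ Icc (a - h) b ∪ Icc b a
    · rw [indicator_of_mem ht, Real.enorm_eq_ofReal_abs, Pi.one_apply, ENNReal.ofReal_le_one]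
      exact abs_ramp_sub_le_one h t a (t < b)
    · rw [indicator_of_notMem ht]
      simp only [mem_union, mem_Icc, not_or, not_and, not_le] at ht
      split_ifs with htb
      · have : t < a - h := by
          by_contra hc
          exact absurd (ht.1 (not_lt.1 hc)) htb.not_gt
        simp [ramp_of_ge hh (show t + h ≤ a by linarith)]
      · simp [ramp_of_le hh (ht.2 (not_lt.1 htb)).le]
  calc ∫⁻ t, ‖ramp h t a - if t < b then 1 else 0‖ₑ
      ≤ ∫⁻ t, (Icc (a - h) b ∪ Icc b a).indicator 1 t := lintegral_mono key
    _ = volume (Icc (a - h) b ∪ Icc b a) :=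
        lintegral_indicator_one (measurableSet_Icc.union measurableSet_Icc)
    _ ≤ volume (Icc (a - h) b) + volume (Icc b a) := measure_union_le _ _
    _ ≤ ‖a - b‖ₑ + ENNReal.ofReal h := by
        rw [Real.volume_Icc, Real.volume_Icc, Real.enorm_eq_ofReal_abs,
          ← ENNReal.ofReal_add (abs_nonneg _) hh.le]
        rcases le_total a b with hab | hab
        · rw [ENNReal.ofReal_of_nonpos (show a - b ≤ 0 by linarith), add_zero]
          exact ENNReal.ofReal_le_ofReal (by linarith [neg_le_abs (a - b)])
        · rw [abs_of_nonneg (sub_nonneg.2 hab)]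
          rcases le_total (b - (a - h)) 0 with h1 | h1
          · rw [ENNReal.ofReal_of_nonpos h1, zero_add]
            exact ENNReal.ofReal_le_ofReal (by linarith)
          · rw [← ENNReal.ofReal_add h1 (by linarith)]
            exact ENNReal.ofReal_le_ofReal (by linarith)

/-- Integrated over the level `t`, the local `L¹` distance between the cut-offs of `v` and the
indicators of the superlevel sets of `u` is controlled by the `L¹` distance of `v` and `u` and by
the width `h`. -/
theorem lintegral_lintegral_enorm_ramp_sub_le {Y : Type*} [MeasurableSpace Y]
    (ν : Measure Y) [SFinite ν] {v u : Y → ℝ}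
    (hv : Measurable v) (hu : Measurable u) {h : ℝ} (hh : 0 < h) :
    Measurable (fun t : ℝ => ∫⁻ x, ‖ramp h t (v x) - {x | t < u x}.indicator (fun _ => 1) x‖ₑ ∂ν) ∧
    ∫⁻ t : ℝ, ∫⁻ x, ‖ramp h t (v x) - {x | t < u x}.indicator (fun _ => 1) x‖ₑ ∂ν ≤
      ∫⁻ x, ‖v x - u x‖ₑ ∂ν + ENNReal.ofReal h * ν univ := by
  classical
  have hm : Measurable fun p : ℝ × Y =>
      ‖ramp h p.1 (v p.2) - if p.1 < u p.2 then (1 : ℝ) else 0‖ₑ := by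
    have h1 : Measurable fun p : ℝ × Y => ramp h p.1 (v p.2) :=
      (continuous_ramp h).measurable.comp (measurable_fst.prodMk (hv.comp measurable_snd))
    exact (h1.sub (Measurable.ite (measurableSet_lt measurable_fst (hu.comp measurable_snd))
      measurable_const measurable_const)).enorm
  simp only [indicator_apply, mem_ofPred_eq]
  refine ⟨hm.lintegral_prod_right', ?_⟩
  rw [lintegral_lintegral_swap hm.aemeasurable]
  calc ∫⁻ x, (∫⁻ t, ‖ramp h t (v x) - if t < u x then (1 : ℝ) else 0‖ₑ) ∂ν
      ≤ ∫⁻ x, (‖v x - u x‖ₑ + ENNReal.ofReal h) ∂ν :=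
        lintegral_mono fun x => lintegral_enorm_ramp_sub_le hh (v x) (u x)
    _ = _ := by rw [lintegral_add_right _ measurable_const, lintegral_const]

/-! ### Elementary properties of the total variation -/

variable [MeasurableSpace X]

theorem totalVariation_univ (ν : Measure X) (u : X → ℝ) :
    totalVariation ν u univ = totalVariationOpen ν u univ := by
  refine le_antisymm (iInf₂_le_of_le univ isOpen_univ (iInf_le _ subset_rfl)) ?_
  refine le_iInf fun A => le_iInf fun _ => le_iInf fun hA => ?_
  rw [univ_subset_iff.1 hA]

theorem totalVariationOpen_le_of_tendsto {ν : Measure X} {u : X → ℝ} {A : Set X} {v : ℕ → X → ℝ}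
    (hv : ∀ n, LocallyLipschitzOn A (v n)) (hvu : TendstoL1Loc ν A v u) :
    totalVariationOpen ν u A ≤ liminf (fun n => ∫⁻ x in A, lip (v n) x ∂ν) atTop :=
  iInf₂_le_of_le v hv (iInf_le _ hvu)

theorem TendstoL1Loc.congr_ae {ν : Measure X} {A : Set X} {v : ℕ → X → ℝ} {u u' : X → ℝ}
    (h : TendstoL1Loc ν A v u) (huu : u =ᵐ[ν] u') : TendstoL1Loc ν A v u' := by
  intro x hx
  obtain ⟨U, hU, hUA, hlim⟩ := h x hx
  refine ⟨U, hU, hUA, hlim.congr fun n => lintegral_congr_ae ?_⟩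
  filter_upwards [ae_restrict_of_ae huu] with y hy
  rw [hy]

theorem totalVariationOpen_congr_ae {ν : Measure X} {u u' : X → ℝ} (h : u =ᵐ[ν] u') (A : Set X) :
    totalVariationOpen ν u A = totalVariationOpen ν u' A := by
  apply le_antisymm
  · exact le_iInf fun v => le_iInf fun hv => le_iInf fun hvu =>
      totalVariationOpen_le_of_tendsto hv (hvu.congr_ae h.symm)
  · exact le_iInf fun v => le_iInf fun hv => le_iInf fun hvu =>
      totalVariationOpen_le_of_tendsto hv (hvu.congr_ae h)

theorem totalVariation_congr_ae {ν : Measure X} {u u' : X → ℝ} (h : u =ᵐ[ν] u') (S : Set X) :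
    totalVariation ν u S = totalVariation ν u' S := by
  simp only [totalVariation, totalVariationOpen_congr_ae h]

theorem totalVariation_const (ν : Measure X) (c : ℝ) (S : Set X) :
    totalVariation ν (fun _ => c) S = 0 := by
  refine le_antisymm (iInf₂_le_of_le univ isOpen_univ (iInf_le_of_le (subset_univ _) ?_)) bot_le
  refine (totalVariationOpen_le_of_tendsto (v := fun _ _ => c)
    (fun _ => (LocallyLipschitz.const c).locallyLipschitzOn) fun x _ =>
      ⟨univ, univ_mem, subset_rfl, by simp⟩).trans ?_
  have : ∀ x : X, lip (fun _ : X => c) x = 0 := fun x =>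
    lip_eq_zero_of_eventually_eq (Eventually.of_forall fun _ => rfl)
  simp [this]

theorem perimeter_self (μ : Measure X) {E : Set X} (hE : MeasurableSet E) :
    perimeter μ E E E = 0 := by
  rw [perimeter, ← totalVariation_const (μ.restrict E) 1 (E ∩ E)]
  refine totalVariation_congr_ae ?_ _
  filter_upwards [ae_restrict_mem hE] with x hx
  simp [hx]

theorem totalVariationOpen_comp_le {ψ : ℝ → ℝ} (hψ : LipschitzWith 1 ψ) (ν : Measure X)
    (u : X → ℝ) (A : Set X) : totalVariationOpen ν (ψ ∘ u) A ≤ totalVariationOpen ν u A := by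
  refine le_iInf fun v => le_iInf fun hv => le_iInf fun hvu => ?_
  refine (totalVariationOpen_le_of_tendsto (v := fun n => ψ ∘ v n) (fun n => ?_) ?_).trans
    (liminf_le_liminf (Eventually.of_forall fun n => lintegral_mono fun x => ?_))
  · intro x hx
    obtain ⟨K, t, ht, hK⟩ := hv n hx
    exact ⟨1 * K, t, ht, hψ.comp_lipschitzOnWith hK⟩
  · intro x hx
    obtain ⟨U, hU, hUA, hlim⟩ := hvu x hx
    refine ⟨U, hU, hUA, tendsto_of_tendsto_of_tendsto_of_le_of_le tendsto_const_nhds hlim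
      (fun _ => bot_le) fun n => lintegral_mono fun y => ?_⟩
    simpa [edist_eq_enorm_sub] using hψ (v n y) (u y)
  · simpa using lip_comp_le hψ (v n) x

theorem totalVariationOpen_indicator_compl_le (ν : Measure X) (H A : Set X) :
    totalVariationOpen ν (Hᶜ.indicator fun _ => (1 : ℝ)) A ≤
      totalVariationOpen ν (H.indicator fun _ => (1 : ℝ)) A := by
  have hψ : LipschitzWith 1 fun s : ℝ => 1 - s :=
    LipschitzWith.of_dist_le_mul fun a b => by
      rw [NNReal.coe_one, one_mul, Real.dist_eq, Real.dist_eq, sub_sub_sub_cancel_left,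
        abs_sub_comm]
  convert totalVariationOpen_comp_le hψ ν (H.indicator fun _ => (1 : ℝ)) A using 2
  ext x
  by_cases hx : x ∈ H <;> simp [hx]

/-! ### The coarea inequality -/

variable [TopologicalSpace.SeparableSpace X]

/-- The neighbourhoods in the definition of local `L¹` convergence can be taken from a countable
family of open sets of finite measure. -/
theorem TendstoL1Loc.exists_countable_cover {ν : Measure X} [IsLocallyFiniteMeasure ν]
    {v : ℕ → X → ℝ} {u : X → ℝ} (h : TendstoL1Loc ν univ v u) :
    ∃ W : ℕ → Set X, (∀ i, IsOpen (W i)) ∧ (∀ i, ν (W i) < ∞) ∧ (∀ x, ∃ i, x ∈ W i) ∧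
      ∀ i, Tendsto (fun n => ∫⁻ y in W i, ‖v n y - u y‖ₑ ∂ν) atTop (𝓝 0) := by
  have : SecondCountableTopology X := UniformSpace.secondCountable_of_separable X
  have hloc : ∀ x, ∃ U : Set X, x ∈ U ∧ IsOpen U ∧ ν U < ∞ ∧
      Tendsto (fun n => ∫⁻ y in U, ‖v n y - u y‖ₑ ∂ν) atTop (𝓝 0) := by
    intro x
    obtain ⟨U, hU, -, hlim⟩ := h x (mem_univ x)
    obtain ⟨V, hxV, hV, hνV⟩ := ν.exists_isOpen_measure_lt_top x
    refine ⟨interior U ∩ V, ⟨mem_interior_iff_mem_nhds.2 hU, hxV⟩, isOpen_interior.inter hV,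
      (measure_mono inter_subset_right).trans_lt hνV, ?_⟩
    exact tendsto_of_tendsto_of_tendsto_of_le_of_le tendsto_const_nhds hlim (fun _ => bot_le)
      fun n => lintegral_mono_set (inter_subset_left.trans interior_subset)
  choose U hxU hUo hUν hUlim using hloc
  obtain ⟨s, hs, hsU⟩ := TopologicalSpace.countable_cover_nhds fun x => (hUo x).mem_nhds (hxU x)
  -- the empty set is added so that the family is nonempty even if `X` is empty
  obtain ⟨W, hW⟩ := ((hs.image U).insert ∅).exists_eq_range (insert_nonempty _ _)
  have hmem : ∀ i, W i = ∅ ∨ ∃ x, U x = W i := by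
    intro i
    have : W i ∈ insert ∅ (U '' s) := hW ▸ mem_range_self i
    rcases this with h0 | ⟨x, -, hx⟩
    exacts [Or.inl h0, Or.inr ⟨x, hx⟩]
  refine ⟨W, fun i => ?_, fun i => ?_, fun x => ?_, fun i => ?_⟩
  · rcases hmem i with h0 | ⟨x, hx⟩
    exacts [h0 ▸ isOpen_empty, hx ▸ hUo x]
  · rcases hmem i with h0 | ⟨x, hx⟩
    exacts [by simp [h0], hx ▸ hUν x]
  · have : x ∈ ⋃ y ∈ s, U y := hsU ▸ mem_univ x
    obtain ⟨y, hy, hxy⟩ := mem_iUnion₂.1 this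
    have : U y ∈ range W := hW ▸ Or.inr (mem_image_of_mem U hy)
    obtain ⟨i, hi⟩ := this
    exact ⟨i, hi ▸ hxy⟩
  · rcases hmem i with h0 | ⟨x, hx⟩
    exacts [by simp [h0], hx ▸ hUlim x]

variable [BorelSpace X]

/-- Averaged over the level `t`, the energy of the cut-off between `t` and `t + h` is at most the
energy of the function. The function `lip v` is not required to be measurable: its integral over
measurable sets is still a measure. -/
theorem lintegral_inv_mul_setLIntegral_lip_le (ν : Measure X) {v : X → ℝ} (hv : Continuous v)
    {h : ℝ} (hh : 0 < h) (hfin : ∫⁻ x, lip v x ∂ν ≠ ∞) :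
    Measurable (fun t : ℝ => (Real.toNNReal h⁻¹ : ℝ≥0∞) *
      ∫⁻ x in {x | t ≤ v x ∧ v x ≤ t + h}, lip v x ∂ν) ∧
    ∫⁻ t : ℝ, (Real.toNNReal h⁻¹ : ℝ≥0∞) *
      ∫⁻ x in {x | t ≤ v x ∧ v x ≤ t + h}, lip v x ∂ν ≤ ∫⁻ x, lip v x ∂ν := by
  have : SecondCountableTopology X := UniformSpace.secondCountable_of_separable X
  set ρ : Measure X := ν.withDensity (lip v) with hρ
  have hρu : ρ univ = ∫⁻ x, lip v x ∂ν := by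
    rw [hρ, withDensity_apply _ MeasurableSet.univ, Measure.restrict_univ]
  have : IsFiniteMeasure ρ := ⟨by rw [hρu]; exact hfin.lt_top⟩
  have hS : MeasurableSet {p : ℝ × X | p.1 ≤ v p.2 ∧ v p.2 ≤ p.1 + h} :=
    (measurableSet_le measurable_fst (hv.measurable.comp measurable_snd)).inter
      (measurableSet_le (hv.measurable.comp measurable_snd) (measurable_fst.add_const h))
  have heq : ∀ t : ℝ, ∫⁻ x in {x | t ≤ v x ∧ v x ≤ t + h}, lip v x ∂ν =
      ρ (Prod.mk t ⁻¹' {p : ℝ × X | p.1 ≤ v p.2 ∧ v p.2 ≤ p.1 + h}) := fun t =>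
    (withDensity_apply _ (measurable_prodMk_left hS)).symm
  simp only [heq]
  have hm := measurable_measure_prodMk_left (ν := ρ) hS
  refine ⟨hm.const_mul _, ?_⟩
  rw [lintegral_const_mul _ hm, ← Measure.prod_apply hS, Measure.prod_apply_symm hS]
  have hvol : ∀ x : X, volume ((fun t : ℝ => (t, x)) ⁻¹'
      {p : ℝ × X | p.1 ≤ v p.2 ∧ v p.2 ≤ p.1 + h}) = ENNReal.ofReal h := by
    intro x
    have : (fun t : ℝ => (t, x)) ⁻¹' {p : ℝ × X | p.1 ≤ v p.2 ∧ v p.2 ≤ p.1 + h} =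
        Icc (v x - h) (v x) := by
      ext t
      simp [and_comm]
    rw [this, Real.volume_Icc]
    congr 1
    ring
  simp only [hvol]
  rw [lintegral_const, hρu, ← mul_assoc, ← ENNReal.ofReal, ← ENNReal.ofReal_mul (by positivity),
    inv_mul_cancel₀ hh.ne', ENNReal.ofReal_one, one_mul]

/-- The coarea inequality, in the form of a measurable bound for the perimeters of superlevel
sets. -/
theorem exists_lintegral_le_of_totalVariationOpen_lt (ν : Measure X) [IsLocallyFiniteMeasure ν]
    {u : X → ℝ} (hu : Measurable u) {c : ℝ≥0∞} (hc : totalVariationOpen ν u univ < c) :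
    ∃ L : ℝ → ℝ≥0∞, Measurable L ∧ ∫⁻ t, L t ≤ c ∧
      ∀ᵐ t, totalVariationOpen ν ({x | t < u x}.indicator fun _ => 1) univ ≤ L t := by
  have : SecondCountableTopology X := UniformSpace.secondCountable_of_separable X
  simp only [totalVariationOpen, iInf_lt_iff] at hc
  obtain ⟨v, hv, hvu, hlim⟩ := hc
  simp only [Measure.restrict_univ] at hlim
  have hv' : ∀ n, LocallyLipschitz (v n) := fun n => locallyLipschitzOn_univ.1 (hv n)
  obtain ⟨W, hWo, hWν, hWx, hWlim⟩ := hvu.exists_countable_cover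
  -- a subsequence with energy below `c` and summable errors on each `W i`
  have hsel : ∀ k : ℕ, ∃ n, ∫⁻ x, lip (v n) x ∂ν < c ∧
      ∀ i ≤ k, ∫⁻ y in W i, ‖v n y - u y‖ₑ ∂ν < 2⁻¹ ^ k := by
    intro k
    refine ((frequently_lt_of_liminf_lt (by isBoundedDefault) hlim).and_eventually ?_).exists
    refine (finite_Iic k).eventually_all.2 fun i _ => (hWlim i).eventually (gt_mem_nhds ?_)
    exact ENNReal.pow_pos (by simp) k
  choose n hn hnW using hsel
  set h : ℕ → ℝ := fun k => 2⁻¹ ^ k with hh_def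
  have hh : ∀ k, 0 < h k := fun k => by positivity
  have hhk : ∀ k, ENNReal.ofReal (h k) = 2⁻¹ ^ k := fun k => by
    rw [hh_def, ENNReal.ofReal_pow (by positivity), ENNReal.ofReal_inv_of_pos two_pos,
      ENNReal.ofReal_ofNat]
  have hcoarea := fun k => lintegral_inv_mul_setLIntegral_lip_le ν (hv' (n k)).continuous (hh k)
    (hn k).ne_top
  refine ⟨_, Measurable.liminf fun k => (hcoarea k).1, ?_, ?_⟩
  · refine (lintegral_liminf_le fun k => (hcoarea k).1).trans ?_
    refine (liminf_le_liminf (Eventually.of_forall fun k =>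
      (hcoarea k).2.trans (hn k).le)).trans ?_
    simp
  have hae : ∀ᵐ t : ℝ, ∀ i, Tendsto (fun k => ∫⁻ x in W i,
      ‖ramp (h k) t (v (n k) x) - {x | t < u x}.indicator (fun _ => 1) x‖ₑ ∂ν) atTop (𝓝 0) := by
    refine ae_all_iff.2 fun i => ?_
    have hb := fun k => lintegral_lintegral_enorm_ramp_sub_le (ν.restrict (W i))
      (hv' (n k)).continuous.measurable hu (hh k)
    -- the error on `W i` is controlled from the index `i` on only
    have hsum : ∫⁻ t : ℝ, ∑' k, ∫⁻ x in W i, ‖ramp (h (k + i)) t (v (n (k + i)) x) -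
        {x | t < u x}.indicator (fun _ => 1) x‖ₑ ∂ν ≠ ∞ := by
      rw [lintegral_tsum fun k => (hb (k + i)).1.aemeasurable]
      have hle : ∀ k, ∫⁻ t : ℝ, ∫⁻ x in W i, ‖ramp (h (k + i)) t (v (n (k + i)) x) -
          {x | t < u x}.indicator (fun _ => 1) x‖ₑ ∂ν ≤ 2⁻¹ ^ k * (1 + ν (W i)) := by
        intro k
        have hpow : (2⁻¹ : ℝ≥0∞) ^ (k + i) ≤ 2⁻¹ ^ k :=
          pow_le_pow_right_of_le_one' (by simp) (Nat.le_add_right k i)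
        refine (hb (k + i)).2.trans ?_
        rw [mul_add, mul_one, hhk, Measure.restrict_apply_univ]
        exact add_le_add ((hnW (k + i) i (Nat.le_add_left i k)).le.trans hpow)
          (mul_le_mul_left hpow _)
      refine ne_top_of_le_ne_top ?_ (ENNReal.tsum_le_tsum hle)
      rw [ENNReal.tsum_mul_right]
      refine ENNReal.mul_ne_top ?_ (by simp [(hWν i).ne])
      simp [ENNReal.tsum_geometric]
    filter_upwards [ae_lt_top (Measurable.tsum fun k => (hb (k + i)).1) hsum] with t ht
    exact (tendsto_add_atTop_iff_nat i).1 (ENNReal.tendsto_atTop_zero_of_tsum_ne_top ht.ne)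
  filter_upwards [hae] with t ht
  refine (totalVariationOpen_le_of_tendsto (v := fun k => ramp (h k) t ∘ v (n k)) (fun k => ?_)
    fun x _ => ?_).trans ?_
  · exact ((lipschitzWith_ramp (hh k) t).locallyLipschitz.comp (hv' (n k))).locallyLipschitzOn
  · obtain ⟨i, hi⟩ := hWx x
    exact ⟨W i, (hWo i).mem_nhds hi, subset_univ _, ht i⟩
  · refine liminf_le_liminf (Eventually.of_forall fun k => ?_)
    have hS : MeasurableSet {x | t ≤ v (n k) x ∧ v (n k) x ≤ t + h k} :=
      (measurableSet_le measurable_const (hv' (n k)).continuous.measurable).inter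
        (measurableSet_le (hv' (n k)).continuous.measurable measurable_const)
    rw [Measure.restrict_univ, ← lintegral_indicator hS,
      ← lintegral_const_mul' _ _ ENNReal.coe_ne_top]
    exact lintegral_mono fun x => lip_ramp_comp_le (hh k) t (hv' (n k)).continuous x

/-- Almost all superlevel sets of a function with vanishing total variation have perimeter zero. -/
theorem ae_totalVariationOpen_superlevel_eq_zero (ν : Measure X) [IsLocallyFiniteMeasure ν]
    {u : X → ℝ} (hu : Measurable u) (h0 : totalVariationOpen ν u univ = 0) :
    ∀ᵐ t : ℝ, totalVariationOpen ν ({x | t < u x}.indicator fun _ => 1) univ = 0 := by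
  have hex := fun j : ℕ => exists_lintegral_le_of_totalVariationOpen_lt ν hu (c := 2⁻¹ ^ j)
    (by rw [h0]; exact ENNReal.pow_pos (by simp) j)
  choose L hLm hL hTV using hex
  have hsum : ∫⁻ t, ∑' j, L j t ≠ ∞ := by
    rw [lintegral_tsum fun j => (hLm j).aemeasurable]
    refine ne_top_of_le_ne_top ?_ (ENNReal.tsum_le_tsum hL)
    simp [ENNReal.tsum_geometric]
  filter_upwards [ae_lt_top (Measurable.tsum hLm) hsum, ae_all_iff.2 hTV] with t ht hle
  exact le_antisymm (ge_of_tendsto' (ENNReal.tendsto_atTop_zero_of_tsum_ne_top ht.ne) hle) bot_le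

end MetricBV

open MetricBV in
theorem mainTheorem12 {X : Type*} [MetricSpace X] [CompleteSpace X]
    [TopologicalSpace.SeparableSpace X] [MeasurableSpace X] [BorelSpace X]
    (μ : Measure X) (hμ : ∀ s : Set X, Bornology.IsBounded s → μ s < ∞)
    (hX : MetricBV.IsIndecomposableWrt μ Set.univ Set.univ)
    (E : Set X) (hE : IsClosed E) (hext : MetricBV.IsHomBVExtensionSet μ E) :
    MetricBV.IsIndecomposableWrt μ E E := by
  have hEm : MeasurableSet E := hE.measurableSet
  refine ⟨⟨hEm, by simp [perimeter_self μ hEm]⟩, ?_⟩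
  rintro ⟨F, G, hF, hG, hFG, hdisj, hFpos, hGpos, hP⟩
  apply hX.2
  have : IsLocallyFiniteMeasure μ :=
    ⟨fun x => ⟨Metric.ball x 1, Metric.ball_mem_nhds x one_pos, hμ _ Metric.isBounded_ball⟩⟩
  have hFE : F ⊆ E := fun x hx => (hFG ▸ Or.inl hx : x ∈ E ∩ E).1
  have hGE : G ⊆ E := fun x hx => (hFG ▸ Or.inr hx : x ∈ E ∩ E).1
  rw [perimeter_self μ hEm, eq_comm, add_eq_zero] at hP
  -- the indicator of `F` as an element of the homogeneous space on `E`
  have hχ : LocallyIntegrable (F.indicator fun _ => (1 : ℝ)) (μ.restrict E) :=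
    (locallyIntegrable_const 1).indicator hF
  set f : X →ₘ[μ.restrict E] ℝ := AEEqFun.mk _ hχ.aestronglyMeasurable
  have hf : (f : X → ℝ) =ᵐ[μ.restrict E] F.indicator fun _ => (1 : ℝ) := AEEqFun.coeFn_mk _ _
  have hf0 : homBVSeminorm μ E f = 0 := by
    rw [homBVSeminorm, totalVariation_congr_ae hf]
    simpa [perimeter] using hP.1
  have hfBV : f ∈ homBV μ E := ⟨hχ.congr hf.symm, by simp [hf0]⟩
  obtain ⟨C, T, -, hTE, hTC⟩ := hext
  set u : X →ₘ[μ.restrict Set.univ] ℝ := (T ⟨f, hfBV⟩ : homBV μ Set.univ).1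
  have hu0 : totalVariationOpen μ u Set.univ = 0 := by
    have h1 : homBVSeminorm μ Set.univ u ≤ C * homBVSeminorm μ E f := hTC ⟨f, hfBV⟩
    have h2 : ∀ w : X → ℝ, totalVariationOpen (μ.restrict Set.univ) w Set.univ =
        totalVariationOpen μ w Set.univ := fun w => by rw [Measure.restrict_univ]
    rwa [hf0, mul_zero, nonpos_iff_eq_zero, homBVSeminorm, totalVariation_univ, h2] at h1
  have hum : Measurable u := u.stronglyMeasurable.measurable
  have huF : ∀ᵐ x ∂μ, x ∈ E → u x = F.indicator (fun _ => (1 : ℝ)) x :=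
    (ae_restrict_iff' hEm).1 ((hTE ⟨f, hfBV⟩).trans hf)
  obtain ⟨t, ⟨ht0, ht1⟩, ht⟩ : ∃ t ∈ Set.Ioo (0 : ℝ) 1,
      totalVariationOpen μ ({x | t < u x}.indicator fun _ => 1) Set.univ = 0 := by
    have hae := ae_totalVariationOpen_superlevel_eq_zero μ hum hu0
    have hfreq : ∃ᵐ t : ℝ, t ∈ Set.Ioo (0 : ℝ) 1 :=
      frequently_ae_mem_iff.2 (by simp)
    exact (hfreq.and_eventually hae).exists
  set H : Set X := {x | t < u x}
  have hHm : MeasurableSet H := measurableSet_lt measurable_const hum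
  refine ⟨H, Hᶜ, hHm, hHm.compl, by simp, disjoint_compl_right, ?_, ?_, ?_⟩
  · refine hFpos.trans_le (measure_mono_ae ?_)
    filter_upwards [huF] with x hx hxF
    change t < u x
    rw [hx (hFE hxF), Set.indicator_of_mem hxF]
    exact ht1
  · refine hGpos.trans_le (measure_mono_ae ?_)
    filter_upwards [huF] with x hx hxG
    change ¬ t < u x
    rw [hx (hGE hxG), Set.indicator_of_notMem fun hxF => hdisj.ne_of_mem hxF hxG rfl]
    exact ht0.le.not_gt
  · have hc := totalVariationOpen_indicator_compl_le μ H Set.univ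
    rw [ht, nonpos_iff_eq_zero] at hc
    rw [perimeter_self μ MeasurableSet.univ]
    simp [perimeter, totalVariation_univ, ht, hc]
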